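/- **Definitions.** Let $n\ge 2$. A Boolean-like algebra of dimension $n$ ($n$BA) is an algebra $\mathbf A=(A,q,\mathsf e_1,\dots,\mathsf e_n)$ with an $(n+1)$-ary operation $q$ and $n$ constants such that $q(\mathsf e_k,x_1,\dots,x_n)=x_k$ for every $k$, and such that every $c\in A$ is $n$-central: the map $f_c=q(c,-,\dots,-):A^n\to A$ is a decomposition operator of $\mathbf A$ (that is, $f_c(x,\dots,x)=x$; $f_c(f_c(x_{11},\dots,x_{1n}),\dots,f_c(x_{n1},\dots,x_{nn}))=f_c(x_{11},\dots,x_{nn})$; and $f_c$ is a homomorphism $\mathbf A^n\to\mathbf A$), and $q(c,\mathsf e_1,\dots,\mathsf e_n)=c$. (A $2$-central element of an algebra $(A,t,\mathsf c_1,\mathsf c_2)$ with $t(\mathsf c_1,x,y)=x$ and $t(\mathsf c_2,x,y)=y$ is defined in the same way with $n=2$.) The $n$BA $\mathbf n$ has the universe $\{\mathsf e_1,\dots,\mathsf e_n\}$, of size $n$, with $q(\mathsf e_k,x_1,\dots,x_n)=x_k$. A multideal of $\mathbf A$ is a tuple $(I_1,\dots,I_n)$ of pairwise disjoint subsets of $A$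 such that (m1) $\mathsf e_k\in I_k$; (m2) if $a\in I_r$, $b\in I_k$ and $y_1,\dots,y_n\in A$, then $q(a,y_1,\dots,y_{r-1},b,y_{r+1},\dots,y_n)\in I_k$; (m3) if $a\in A$ and $y_1,\dots,y_n\in I_k$, then $q(a,y_1,\dots,y_n)\in I_k$. Its carrier is $I_1\cup\dots\cup I_n$. An ultramultideal is a multideal whose carrier is $A$. A multideal $(G_k)_k$ extends $(I_k)_k$ if $I_k\subseteq G_k$ for all $k$. Let $t_k(x,y,z)=q(x,y,\dots,y,z,y,\dots,y)$ with $z$ at position $k$. For $i\neq j$, let $B_{ij}$ be the Boolean algebra of $2$-central elements of $(A,t_i,\mathsf e_j,\mathsf e_i)$, with bottom $\mathsf e_i$, top $\mathsf e_j$, meet $t_i(x,y,\mathsf e_i)$ and complement $t_i(x,\mathsf e_i,\mathsf e_j)$. The coordinates of $x\in A$ are $x_k=t_k(x,\mathsf e_i,\mathsf e_j)$, $1\le k\le n$. **Theorem (ultramultideals).** Let $\mathbf A$ be an $n$BA. (i) Every multideal $(I_k)_k$ of $\mathbf A$ extends to an ultramultideal. Moreover, for all $i\ne j$ there is an ultrafilter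 $U$ of $B_{ij}$ with $B_{ij}\cap I_j\subseteq U$, and for every such $U$ the tuple $(G_k)_k$ with $G_k=\{x\in A: x_k\in U\}$ is an ultramultideal that extends $(I_k)_k$. (ii) The map $h\mapsto (h^{-1}(\mathsf e_1),\dots,h^{-1}(\mathsf e_n))$ is a bijection from the set of homomorphisms of $\mathbf A$ onto $\mathbf n$ to the set of ultramultideals of $\mathbf A$. -/

import Mathlib

/-- A (pure) Church algebra of dimension `n` on the set `A`: an operation `q` of arity `n + 1` and
`n` constants `e` with `q(e_k, x_1, …, x_n) = x_k`. Indices run through `Fin n`. -/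
structure ChurchAlgebra (n : ℕ) (A : Type*) where
  q : A → (Fin n → A) → A
  e : Fin n → A
  q_e : ∀ (k : Fin n) (x : Fin n → A), q (e k) x = x k

namespace ChurchAlgebra

variable {n : ℕ} {A B : Type*}

/-- `f` is an `n`-ary decomposition operator on the algebra `(A, q, e_1, …, e_n)`. The third
and the fourth field say that `f` is a homomorphism from the `n`-th power of the algebra to the
algebra: it commutes with `q` and with the constants. -/
structure IsDecompositionOperator (C : ChurchAlgebra n A) (f : (Fin n → A) → A) : Prop where
  diag_const : ∀ x : A, f (fun _ => x) = x
  diag : ∀ x : Fin n → Fin n → A, f (fun k => f (x k)) = f (fun k => x k k)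
  map_q : ∀ (u : Fin n → A) (x : Fin n → Fin n → A),
    f (fun k => C.q (u k) (x k)) = C.q (f u) (fun m => f (fun k => x k m))
  map_e : ∀ m : Fin n, f (fun _ => C.e m) = C.e m

/-- `c` is a factor element: `f_c = q(c, -, …, -)` is a decomposition operator. -/
def IsFactor (C : ChurchAlgebra n A) (c : A) : Prop :=
  C.IsDecompositionOperator (C.q c)

/-- `c` is `n`-central: a factor element with `q(c, e_1, …, e_n) = c`. -/
def IsCentral (C : ChurchAlgebra n A) (c : A) : Prop :=
  C.IsFactor c ∧ C.q c C.e = c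

/-- Homomorphisms of pure Church algebras of dimension `n`. -/
structure IsHom (C : ChurchAlgebra n A) (D : ChurchAlgebra n B) (h : A → B) : Prop where
  map_q : ∀ (a : A) (x : Fin n → A), h (C.q a x) = D.q (h a) (fun k => h (x k))
  map_e : ∀ k : Fin n, h (C.e k) = D.e k

/-- `t_k(x, y, z) = q(x, y, …, y, z, y, …, y)`, with `z` at position `k`. -/
def t (C : ChurchAlgebra n A) (k : Fin n) (x y z : A) : A :=
  C.q x (fun m => if m = k then z else y)

/-- The Church algebra of dimension 2 `(A, t_i, e_i, e_j)`, for `i ≠ j`. Since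
`t_i(e_j, y, z) = y` and `t_i(e_i, y, z) = z`, its first constant is `e_j`, the Boolean one,
and its second constant is `e_i`, the Boolean zero. -/
def reduct (C : ChurchAlgebra n A) (i j : Fin n) (hij : i ≠ j) : ChurchAlgebra 2 A where
  q x y := C.t i x (y 0) (y 1)
  e := ![C.e j, C.e i]
  q_e k x := by
    fin_cases k
    · simp [t, C.q_e, hij.symm]
    · simp [t, C.q_e]

/-- The carrier of the Boolean center `B_ij`: the 2-central elements of `(A, t_i, e_i, e_j)`. -/
def center (C : ChurchAlgebra n A) (i j : Fin n) (hij : i ≠ j) : Set A :=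
  {x | (C.reduct i j hij).IsCentral x}

/-- The meet of the Boolean algebra `B_ij`; its bottom is `e_i` and its top is `e_j`. -/
def meet (C : ChurchAlgebra n A) (i : Fin n) (x y : A) : A := C.t i x y (C.e i)

/-- The complement of the Boolean algebra `B_ij`. -/
def compl (C : ChurchAlgebra n A) (i j : Fin n) (x : A) : A := C.t i x (C.e i) (C.e j)

/-- `U` is an ultrafilter of the Boolean algebra `B_ij`: a proper filter that contains `x` or the
complement of `x`, for every `x` in `B_ij`. The order of `B_ij` is `x ≤ y ↔ x ∧ y = x`. -/
structure IsUltrafilter (C : ChurchAlgebra n A) (i j : Fin n) (hij : i ≠ j) (U : Set A) :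
    Prop where
  subset : U ⊆ C.center i j hij
  top_mem : C.e j ∈ U
  bot_notMem : C.e i ∉ U
  meet_mem : ∀ x ∈ U, ∀ y ∈ U, C.meet i x y ∈ U
  mem_of_le : ∀ x ∈ U, ∀ y ∈ C.center i j hij, C.meet i x y = x → y ∈ U
  mem_or_compl_mem : ∀ x ∈ C.center i j hij, x ∈ U ∨ C.compl i j x ∈ U

/-- The coordinate `x_k = t_k(x, e_i, e_j)` of `x`. -/
def coord (C : ChurchAlgebra n A) (i j k : Fin n) (x : A) : A := C.t k x (C.e i) (C.e j)

/-- The tuple `(I_1, …, I_n)` of subsets of `A` is a multideal. That it is an `n`-partition of its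
carrier, the union of the `I_k`, means that the `I_k` are pairwise disjoint. -/
structure IsMultideal (C : ChurchAlgebra n A) (I : Fin n → Set A) : Prop where
  disjoint : ∀ r k : Fin n, r ≠ k → Disjoint (I r) (I k)
  e_mem : ∀ k : Fin n, C.e k ∈ I k
  q_mem : ∀ (r k : Fin n) (a b : A) (y : Fin n → A), a ∈ I r → b ∈ I k →
    C.q a (Function.update y r b) ∈ I k
  q_mem_of_forall : ∀ (k : Fin n) (a : A) (y : Fin n → A), (∀ m, y m ∈ I k) → C.q a y ∈ I k

/-- An ultramultideal is a multideal whose carrier is all of `A`. -/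
def IsUltramultideal (C : ChurchAlgebra n A) (I : Fin n → Set A) : Prop :=
  C.IsMultideal I ∧ ⋃ k, I k = Set.univ

end ChurchAlgebra

/-- A Boolean-like algebra of dimension `n` (`n`BA): a pure Church algebra of dimension `n` all of
whose elements are `n`-central. -/
structure BooleanLikeAlgebra (n : ℕ) (A : Type*) extends ChurchAlgebra n A where
  central : ∀ a : A, toChurchAlgebra.IsCentral a

/-- The `n`-element `n`BA, `n = {e_1, …, e_n}` with `q(e_k, x_1, …, x_n) = x_k`. -/
def standardAlgebra (n : ℕ) : BooleanLikeAlgebra n (Fin n) where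
  q k x := x k
  e k := k
  q_e _ _ := rfl
  central _ := ⟨⟨fun _ => rfl, fun _ => rfl, fun _ _ => rfl, fun _ => rfl⟩, rfl⟩

/-!
In an `n`BA every map `q(c, -, …, -)` is a decomposition operator, so it fixes constant tuples,
collapses on diagonals (`q_diag`), and commutes with every other `q(d, -, …, -)` (`q_comm`); also
`q(q(c, u), y) = q(c, q(u_1, y), …, q(u_n, y))` (`q_q`). All computations reduce to these laws.

Part (ii) needs only the definitions. An ultramultideal assigns to each element the index of the
unique class containing it, and (m2) says exactly that this assignment is a homomorphism.

For part (i), the idea is that `q(a, z_1, …, z_n)` behaves like "the value `z_m` where `a` equals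
`e_m`", and that the coordinate `a_k` behaves like the region where `a` equals `e_k`. The coordinates
of `a` are pairwise disjoint elements of `B_ij` and their complements meet to the bottom, so an
ultrafilter `U` contains exactly one of them (`eq_of_coord_mem`, `exists_coord_mem`). Because
`a_r ∧ (y_r)_k ≤ q(a, y)_k` (`meet_coord_le`), the classes `{x | x_k ∈ U}` form an ultramultideal.
It extends `I` because `x ∈ I_k` gives `x_k ∈ I_j` by (m2). Finally, `B_ij ∩ I_j` is closed under
meets and omits the bottom, so Zorn's lemma puts it inside an ultrafilter
(`exists_isUltrafilter`).
-/

open Function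

namespace BooleanLikeAlgebra

variable {n : ℕ} {A : Type*} (C : BooleanLikeAlgebra n A)

/-! ### Equational laws of the operation -/

theorem q_const (c x : A) : C.q c (fun _ => x) = x := (C.central c).1.diag_const x

theorem q_diag (c : A) (x : Fin n → Fin n → A) :
    C.q c (fun k => C.q c (x k)) = C.q c (fun k => x k k) := (C.central c).1.diag x

theorem q_map (c : A) (u : Fin n → A) (x : Fin n → Fin n → A) :
    C.q c (fun k => C.q (u k) (x k)) = C.q (C.q c u) (fun m => C.q c (fun k => x k m)) :=
  (C.central c).1.map_q u x

theorem q_q (c : A) (u y : Fin n → A) : C.q (C.q c u) y = C.q c (fun k => C.q (u k) y) := by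
  simp [q_map, q_const]

theorem q_comm (c d : A) (x : Fin n → Fin n → A) :
    C.q c (fun k => C.q d (x k)) = C.q d (fun m => C.q c (fun k => x k m)) := by
  simpa [q_const] using C.q_map c (fun _ => d) x

/-! ### The ternary operations -/

theorem t_const (i : Fin n) (x y : A) : C.t i x y y = y := by
  simp [ChurchAlgebra.t, q_const]

theorem t_e_self (i : Fin n) (y z : A) : C.t i (C.e i) y z = z := by
  simp [ChurchAlgebra.t, C.q_e]

theorem t_e_of_ne {i k : Fin n} (h : k ≠ i) (y z : A) : C.t i (C.e k) y z = y := by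
  simp [ChurchAlgebra.t, C.q_e, h]

theorem t_q (i : Fin n) (a : A) (u : Fin n → A) (y z : A) :
    C.t i (C.q a u) y z = C.q a (fun m => C.t i (u m) y z) := C.q_q a u _

theorem t_map (i : Fin n) (x u₀ u₁ a b c d : A) :
    C.t i x (C.t i u₀ a b) (C.t i u₁ c d) =
      C.t i (C.t i x u₀ u₁) (C.t i x a c) (C.t i x b d) := by
  have h := C.q_map x (fun m => if m = i then u₁ else u₀)
    (fun m k => if m = i then (if k = i then d else c) else (if k = i then b else a))
  simp only [ChurchAlgebra.t]
  convert h using 2 <;> funext m <;> split_ifs <;> rfl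

theorem t_diag (i : Fin n) (x a b c d : A) :
    C.t i x (C.t i x a b) (C.t i x c d) = C.t i x a d := by
  have h := C.q_diag x
    (fun m k => if m = i then (if k = i then d else c) else (if k = i then b else a))
  simp only [ChurchAlgebra.t]
  convert h using 2 <;> funext m <;> split_ifs <;> rfl

theorem t_t (i : Fin n) (x u v y z : A) :
    C.t i (C.t i x u v) y z = C.t i x (C.t i u y z) (C.t i v y z) := by
  rw [t_map, t_const, t_const]

theorem t_comm (i : Fin n) (x y a b c d : A) :
    C.t i x (C.t i y a b) (C.t i y c d) = C.t i y (C.t i x a c) (C.t i x b d) := by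
  rw [t_map, t_const]

/-! ### The Boolean center -/

section center

variable {i j : Fin n} (hij : i ≠ j)

/-- Every element of an `n`BA is a factor element of the reduct `(A, t_i, e_j, e_i)`, so only the
identity `t_i(x, e_j, e_i) = x` is left of 2-centrality. -/
theorem mem_center {x : A} : x ∈ C.center i j hij ↔ C.t i x (C.e j) (C.e i) = x := by
  refine ⟨fun h => h.2, fun h => ⟨⟨fun y => ?_, fun y => ?_, fun u y => ?_, fun m => ?_⟩, h⟩⟩
  · exact C.t_const i x y
  · exact C.t_diag i x _ _ _ _
  · exact C.t_map i x _ _ _ _ _ _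
  · exact C.t_const i x _

theorem e_left_mem_center : C.e i ∈ C.center i j hij := by
  rw [mem_center, t_e_self]

theorem e_right_mem_center : C.e j ∈ C.center i j hij := by
  rw [mem_center, C.t_e_of_ne hij.symm]

theorem t_mem_center {x y z : A} (hy : y ∈ C.center i j hij) (hz : z ∈ C.center i j hij) :
    C.t i x y z ∈ C.center i j hij := by
  rw [mem_center] at *
  rw [t_t, hy, hz]

theorem q_mem_center (a : A) {z : Fin n → A} (hz : ∀ m, z m ∈ C.center i j hij) :
    C.q a z ∈ C.center i j hij := by
  simp only [mem_center] at *
  simp [t_q, hz]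

theorem meet_mem_center {x y : A} (hy : y ∈ C.center i j hij) :
    C.meet i x y ∈ C.center i j hij :=
  C.t_mem_center hij hy (C.e_left_mem_center hij)

theorem compl_mem_center (x : A) : C.compl i j x ∈ C.center i j hij :=
  C.t_mem_center hij (C.e_left_mem_center hij) (C.e_right_mem_center hij)

theorem coord_mem_center (k : Fin n) (x : A) : C.coord i j k x ∈ C.center i j hij := by
  refine C.q_mem_center hij x fun m => ?_
  split_ifs
  exacts [C.e_right_mem_center hij, C.e_left_mem_center hij]

theorem meet_self {x : A} (hx : x ∈ C.center i j hij) : C.meet i x x = x := by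
  rw [mem_center] at hx
  have h := C.t_diag i x (C.e j) (C.e i) (C.e i) (C.e i)
  rwa [hx, t_const] at h

theorem meet_comm {x y : A} (hx : x ∈ C.center i j hij) (hy : y ∈ C.center i j hij) :
    C.meet i x y = C.meet i y x := by
  rw [mem_center] at hx hy
  have h := C.t_comm i x y (C.e j) (C.e i) (C.e i) (C.e i)
  rwa [hx, hy, t_const, t_const] at h

theorem meet_assoc (x y z : A) : C.meet i (C.meet i x y) z = C.meet i x (C.meet i y z) := by
  simp [ChurchAlgebra.meet, t_t, t_e_self]

theorem top_meet (hij : i ≠ j) (x : A) : C.meet i (C.e j) x = x := C.t_e_of_ne hij.symm _ _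

theorem bot_meet (x : A) : C.meet i (C.e i) x = C.e i := C.t_e_self _ _ _

theorem meet_compl_of_meet_eq_bot {x y : A} (hx : x ∈ C.center i j hij)
    (h : C.meet i x y = C.e i) : C.meet i x (C.compl i j y) = x := by
  rw [mem_center] at hx
  -- the complement of `x ∧ y` is `t_i(x, yᶜ, e_j)`, and it is the top because `x ∧ y` is the bottom
  have h₁ : C.t i x (C.t i y (C.e i) (C.e j)) (C.e j) = C.e j := by
    have h₂ := congrArg (fun w => C.t i w (C.e i) (C.e j)) h
    simpa only [ChurchAlgebra.meet, t_t, t_e_self] using h₂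
  have h₂ := C.t_diag i x (C.t i y (C.e i) (C.e j)) (C.e j) (C.e i) (C.e i)
  rw [h₁, t_const, hx] at h₂
  exact h₂.symm

end center

/-! ### Coordinates with respect to an ultrafilter -/

section ultrafilter

variable {i j : Fin n} {hij : i ≠ j} {U : Set A}

/-- The meet of two values of `q(a, -, …, -)` is computed entrywise. -/
theorem meet_q_q (a : A) (s u : Fin n → A) :
    C.meet i (C.q a s) (C.q a u) = C.q a (fun m => C.meet i (s m) (u m)) := by
  have h : ∀ m, C.meet i (s m) (C.q a u) = C.q a (fun l => C.meet i (s m) (u l)) := fun m => by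
    simp only [ChurchAlgebra.meet, ChurchAlgebra.t]
    rw [C.q_comm a (s m) (fun l k => if k = i then C.e i else u l)]
    congr 1
    funext k
    split_ifs <;> simp [q_const]
  calc C.meet i (C.q a s) (C.q a u) = C.q a (fun m => C.meet i (s m) (C.q a u)) := C.t_q i a s _ _
    _ = _ := by simp only [h, q_diag]

theorem coord_q (k : Fin n) (a : A) (y : Fin n → A) :
    C.coord i j k (C.q a y) = C.q a (fun m => C.coord i j k (y m)) := C.t_q k a y _ _

theorem coord_e (k : Fin n) : C.coord i j k (C.e k) = C.e j := C.t_e_self _ _ _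

/-- The meet with the coordinate `a_r` cuts off all entries but the one at `r`. -/
theorem coord_meet (hij : i ≠ j) (r : Fin n) (a z : A) :
    C.meet i (C.coord i j r a) z = C.q a (fun m => if m = r then z else C.e i) := by
  refine (C.t_q i a _ _ _).trans ?_
  congr 1
  funext m
  split_ifs
  exacts [C.t_e_of_ne hij.symm _ _, C.t_e_self _ _ _]

theorem meet_coord_le (hij : i ≠ j) (r k : Fin n) (a : A) (y : Fin n → A) :
    C.meet i (C.meet i (C.coord i j r a) (C.coord i j k (y r))) (C.coord i j k (C.q a y)) =
      C.meet i (C.coord i j r a) (C.coord i j k (y r)) := by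
  rw [C.coord_meet hij, coord_q, meet_q_q]
  congr 1
  funext m
  split_ifs with h
  · rw [h, C.meet_self hij (C.coord_mem_center hij k (y r))]
  · exact C.bot_meet _

variable {C} in
theorem coord_q_mem (hU : C.IsUltrafilter i j hij U) {r k : Fin n} {a : A} {y : Fin n → A}
    (ha : C.coord i j r a ∈ U) (hy : C.coord i j k (y r) ∈ U) : C.coord i j k (C.q a y) ∈ U :=
  hU.mem_of_le _ (hU.meet_mem _ ha _ hy) _ (C.coord_mem_center hij k _) (C.meet_coord_le hij r k a y)

variable {C} in
theorem eq_of_coord_mem (hU : C.IsUltrafilter i j hij U) {r k : Fin n} {a : A}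
    (hr : C.coord i j r a ∈ U) (hk : C.coord i j k a ∈ U) : r = k := by
  by_contra h
  have h₁ : C.meet i (C.coord i j r a) (C.coord i j k a) = C.e i := by
    refine (C.meet_q_q a _ _).trans ?_
    conv_rhs => rw [← C.q_const a (C.e i)]
    congr 1
    funext m
    by_cases hm : m = r
    · subst hm
      simp [h, C.top_meet hij]
    · simp [hm, C.bot_meet]
  exact hU.bot_notMem (h₁ ▸ hU.meet_mem _ hr _ hk)

variable {C} in
theorem exists_coord_mem (hU : C.IsUltrafilter i j hij U) (a : A) : ∃ k, C.coord i j k a ∈ U := by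
  by_contra! h
  -- `U` contains the meet of the complements of the coordinates in any finite set `S` of indices
  have key : ∀ S : Finset (Fin n), C.q a (fun m => if m ∈ S then C.e i else C.e j) ∈ U := by
    intro S
    induction S using Finset.induction_on with
    | empty => simpa [q_const] using hU.top_mem
    | insert r S _ ih =>
      have hr := (hU.mem_or_compl_mem _ (C.coord_mem_center hij r a)).resolve_left (h r)
      have hc : C.compl i j (C.coord i j r a) =
          C.q a (fun m => if m = r then C.e i else C.e j) := by
        refine (C.t_q i a _ _ _).trans ?_
        congr 1
        funext m
        split_ifs
        exacts [C.t_e_of_ne hij.symm _ _, C.t_e_self _ _ _]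
      have hm := hU.meet_mem _ (hc ▸ hr) _ ih
      rw [meet_q_q] at hm
      convert hm using 2
      funext m
      by_cases hmr : m = r
      · simp [hmr, C.bot_meet]
      · simp [hmr, C.top_meet hij]
  exact hU.bot_notMem (by simpa [q_const] using key Finset.univ)

variable {C} in
theorem isUltramultideal_coord (hU : C.IsUltrafilter i j hij U) :
    C.IsUltramultideal (fun k => {x | C.coord i j k x ∈ U}) := by
  refine ⟨⟨fun r k hrk => ?_, fun k => ?_, fun r k a b y ha hb => ?_, fun k a y hy => ?_⟩, ?_⟩
  · exact Set.disjoint_left.2 fun x hr hk => hrk (eq_of_coord_mem hU hr hk)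
  · simpa [coord_e] using hU.top_mem
  · exact coord_q_mem hU ha (by simpa using hb)
  · obtain ⟨r, hr⟩ := exists_coord_mem hU a
    exact coord_q_mem hU hr (hy r)
  · exact Set.eq_univ_of_forall fun x => Set.mem_iUnion.2 (exists_coord_mem hU x)

end ultrafilter

/-! ### Ultrafilters above a multideal -/

section multideal

variable {C} {I : Fin n → Set A} {i j : Fin n}

theorem coord_mem_of_mem (hI : C.IsMultideal I) {k : Fin n} {x : A} (hx : x ∈ I k) :
    C.coord i j k x ∈ I j := by
  have h := hI.q_mem k j x (C.e j) (fun _ => C.e i) hx (hI.e_mem j)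
  convert h using 1
  refine congrArg (C.q x) (funext fun m => ?_)
  simp [update_apply]

theorem meet_mem_of_mem (hI : C.IsMultideal I) (hij : i ≠ j) {x y : A} (hx : x ∈ I j)
    (hy : y ∈ I j) : C.meet i x y ∈ I j := by
  have h := hI.q_mem j j x y (fun m => if m = i then C.e i else y) hx hy
  rwa [show update (fun m => if m = i then C.e i else y) j y = fun m => if m = i then C.e i else y
    from update_eq_self_iff.2 (by simp [hij.symm])] at h

/-- A set of elements of `B_ij` that contains the top, is closed under meets and omits the bottom
is contained in an ultrafilter, namely in any maximal set of that kind. -/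
theorem exists_isUltrafilter (hij : i ≠ j) {F : Set A} (hF : F ⊆ C.center i j hij)
    (htop : C.e j ∈ F) (hbot : C.e i ∉ F) (hmeet : ∀ x ∈ F, ∀ y ∈ F, C.meet i x y ∈ F) :
    ∃ U, C.IsUltrafilter i j hij U ∧ F ⊆ U := by
  obtain ⟨U, hFU, hmax⟩ := zorn_subset_nonempty
    {S : Set A | S ⊆ C.center i j hij ∧ C.e i ∉ S ∧ ∀ x ∈ S, ∀ y ∈ S, C.meet i x y ∈ S}
    (fun c hc hchain _ => by
      refine ⟨⋃₀ c, ⟨Set.sUnion_subset fun s hs => (hc hs).1, ?_, ?_⟩,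
        fun s hs => Set.subset_sUnion_of_mem hs⟩
      · rintro ⟨s, hs, h⟩
        exact (hc hs).2.1 h
      · rintro x ⟨s, hs, hx⟩ y ⟨s', hs', hy⟩
        rcases hchain.total hs hs' with h | h
        · exact ⟨s', hs', (hc hs').2.2 x (h hx) y hy⟩
        · exact ⟨s, hs, (hc hs).2.2 x hx y (h hy)⟩) F ⟨hF, hbot, hmeet⟩
  obtain ⟨hU, hUbot, hUmeet⟩ := hmax.prop
  have hUtop : C.e j ∈ U := hFU htop
  -- an element whose meet with every member of `U` is nonzero can be adjoined, so it lies in `U`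
  have key : ∀ x ∈ C.center i j hij, (∀ f ∈ U, C.meet i f x ≠ C.e i) → x ∈ U := by
    intro x hx hne
    have hle : U ⊆ U ∪ (fun f => C.meet i f x) '' U := Set.subset_union_left
    refine hmax.le_of_ge ⟨?_, ?_, ?_⟩ hle (Or.inr ⟨_, hUtop, C.top_meet hij x⟩)
    · rintro y (hy | ⟨f, -, rfl⟩)
      exacts [hU hy, C.meet_mem_center hij hx]
    · rintro (hy | ⟨f, hf, h⟩)
      exacts [hUbot hy, hne f hf h]
    · rintro y (hy | ⟨f, hf, rfl⟩) z (hz | ⟨g, hg, rfl⟩)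
      · exact Or.inl (hUmeet y hy z hz)
      · exact Or.inr ⟨_, hUmeet y hy g hg, C.meet_assoc _ _ _⟩
      · refine Or.inr ⟨_, hUmeet f hf z hz, ?_⟩
        simp only [C.meet_assoc]
        rw [C.meet_comm hij hx (hU hz)]
      · refine Or.inr ⟨_, hUmeet f hf g hg, ?_⟩
        simp only [C.meet_assoc]
        rw [C.meet_comm hij hx (C.meet_mem_center hij hx), C.meet_assoc, C.meet_self hij hx]
  have hup : ∀ x ∈ U, ∀ y ∈ C.center i j hij, C.meet i x y = x → y ∈ U := by
    intro x hx y hy hxy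
    refine key y hy fun f hf h => hUbot ?_
    have h₁ : C.meet i f x = C.e i := by
      rw [← hxy, C.meet_comm hij (hU hx) hy, ← C.meet_assoc, h, C.bot_meet]
    exact h₁ ▸ hUmeet f hf x hx
  refine ⟨U, ⟨hU, hUtop, hUbot, hUmeet, hup, fun x hx => ?_⟩, hFU⟩
  by_contra! hnot
  refine hnot.1 (key x hx fun f hf h => hnot.2 ?_)
  exact hup f hf _ (C.compl_mem_center hij x) (C.meet_compl_of_meet_eq_bot hij (hU hf) h)

theorem exists_isUltrafilter_of_isMultideal (hI : C.IsMultideal I) (hij : i ≠ j) :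
    ∃ U, C.IsUltrafilter i j hij U ∧ C.center i j hij ∩ I j ⊆ U :=
  exists_isUltrafilter hij Set.inter_subset_left ⟨C.e_right_mem_center hij, hI.e_mem j⟩
    (fun h => Set.disjoint_left.1 (hI.disjoint i j hij) (hI.e_mem i) h.2)
    (fun _ hx _ hy => ⟨C.meet_mem_center hij hy.1, meet_mem_of_mem hI hij hx.2 hy.2⟩)

theorem subset_coord (hI : C.IsMultideal I) {hij : i ≠ j} {U : Set A}
    (hIU : C.center i j hij ∩ I j ⊆ U) (k : Fin n) : I k ⊆ {x | C.coord i j k x ∈ U} :=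
  fun x hx => hIU ⟨C.coord_mem_center hij k x, coord_mem_of_mem hI hx⟩

end multideal

/-! ### Homomorphisms onto the `n`-element algebra -/

theorem isUltramultideal_preimage {h : A → Fin n}
    (hh : C.IsHom (standardAlgebra n).toChurchAlgebra h) :
    C.IsUltramultideal (fun k => h ⁻¹' {k}) := by
  have hq : ∀ a x, h (C.q a x) = h (x (h a)) := hh.map_q
  refine ⟨⟨fun r k hrk => ?_, hh.map_e, fun r k a b y ha hb => ?_, fun k a y hy => ?_⟩, ?_⟩
  · exact Disjoint.preimage h (Set.disjoint_singleton.2 hrk)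
  · obtain rfl : h a = r := ha
    simpa [hq] using hb
  · simpa [hq] using hy (h a)
  · exact Set.eq_univ_of_forall fun x => Set.mem_iUnion.2 ⟨h x, rfl⟩

theorem exists_isHom_of_isUltramultideal {G : Fin n → Set A} (hG : C.IsUltramultideal G) :
    ∃ h : A → Fin n, C.IsHom (standardAlgebra n).toChurchAlgebra h ∧
      (fun k => h ⁻¹' {k}) = G := by
  obtain ⟨hG, hcover⟩ := hG
  have hex : ∀ x, ∃ k, x ∈ G k := fun x => Set.mem_iUnion.1 (hcover ▸ Set.mem_univ x)
  choose h hmem using hex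
  have huniq : ∀ {x k}, x ∈ G k → h x = k := fun {x k} hx => by
    by_contra hne
    exact Set.disjoint_left.1 (hG.disjoint _ _ hne) (hmem x) hx
  refine ⟨h, ⟨fun a x => huniq ?_, fun k => huniq (hG.e_mem k)⟩, ?_⟩
  · have hq := hG.q_mem (h a) (h (x (h a))) a (x (h a)) x (hmem a) (hmem _)
    rwa [update_eq_self] at hq
  · funext k
    ext x
    exact ⟨fun hx => (show h x = k from hx) ▸ hmem x, huniq⟩

end BooleanLikeAlgebra

open BooleanLikeAlgebra

theorem theorem7p12 {n : ℕ} (hn : 2 ≤ n) {A : Type*} (C : BooleanLikeAlgebra n A) :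
    -- (i) every multideal extends to an ultramultideal; the extensions come from the
    -- ultrafilters of `B_ij` above `B_ij ∩ I_j`, of which there is at least one
    (∀ I : Fin n → Set A, C.IsMultideal I →
      (∃ G : Fin n → Set A, C.IsUltramultideal G ∧ ∀ k, I k ⊆ G k) ∧
      ∀ (i j : Fin n) (hij : i ≠ j),
        (∃ U : Set A, C.IsUltrafilter i j hij U ∧ C.center i j hij ∩ I j ⊆ U) ∧
        ∀ U : Set A, C.IsUltrafilter i j hij U → C.center i j hij ∩ I j ⊆ U →
          C.IsUltramultideal (fun k => {x | C.coord i j k x ∈ U}) ∧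
          ∀ k, I k ⊆ {x | C.coord i j k x ∈ U}) ∧
    -- (ii) `h ↦ (h⁻¹(e_1), …, h⁻¹(e_n))` is a bijection from the homomorphisms of `A` onto the
    -- `n`-element algebra to the ultramultideals of `A`
    Set.BijOn
      (fun (h : A → Fin n) (k : Fin n) => h ⁻¹' {(standardAlgebra n).e k})
      {h : A → Fin n | C.IsHom (standardAlgebra n).toChurchAlgebra h ∧ Function.Surjective h}
      {G : Fin n → Set A | C.IsUltramultideal G} := by
  refine ⟨fun I hI => ?_, ?_, ?_, ?_⟩
  · have ext_of_ne : ∀ (i j : Fin n) (hij : i ≠ j),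
        (∃ U : Set A, C.IsUltrafilter i j hij U ∧ C.center i j hij ∩ I j ⊆ U) ∧
        ∀ U : Set A, C.IsUltrafilter i j hij U → C.center i j hij ∩ I j ⊆ U →
          C.IsUltramultideal (fun k => {x | C.coord i j k x ∈ U}) ∧
          ∀ k, I k ⊆ {x | C.coord i j k x ∈ U} := fun i j hij =>
      ⟨exists_isUltrafilter_of_isMultideal hI hij, fun U hU hIU =>
        ⟨isUltramultideal_coord hU, subset_coord hI hIU⟩⟩
    have h01 : (⟨0, by omega⟩ : Fin n) ≠ ⟨1, by omega⟩ := by simp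
    obtain ⟨⟨U, hU, hIU⟩, hext⟩ := ext_of_ne _ _ h01
    exact ⟨⟨_, hext U hU hIU⟩, ext_of_ne⟩
  · exact fun h hh => C.isUltramultideal_preimage hh.1
  · intro h _ h' _ heq
    funext x
    have hx : x ∈ h' ⁻¹' {h x} := by
      rw [← show h ⁻¹' {h x} = h' ⁻¹' {h x} from congrFun heq (h x)]
      rfl
    exact hx.symm
  · intro G hG
    obtain ⟨h, hh, hhG⟩ := C.exists_isHom_of_isUltramultideal hG
    exact ⟨h, ⟨hh, fun k => ⟨C.e k, hh.map_e k⟩⟩, hhG⟩
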